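/- Let $E$ be a finite set, $I\subseteq E\times E$ an irreflexive symmetric relation, and $M(E,I)$ the free partially commutative monoid, i.e. the monoid with generators $E$ and relations $ab=ba$ for $(a,b)\in I$. Let $X_0^\bullet=\{x_0,*\}$ (with $x_0\neq *$) be the right pointed $M(E,I)$-set with base point $*$ in which $*\cdot\mu=*$ for all $\mu\in M(E,I)$ and $x_0\cdot e=*$ for every $e\in E$. Let $\mathfrak{Cat}_*[X_0^\bullet]$ be the category whose objects are the elements of $X_0^\bullet$ and whose morphisms $x\to x'$ are the elements $\mu\in M(E,I)$ with $x\cdot\mu=x'$, the composite of $x\xrightarrow{\mu}x'$ and $x'\xrightarrow{\mu'}x''$ being $x\xrightarrow{\mu\mu'}x''$. Let $\mathbb{Z}[x_0]:\mathfrak{Cat}_*[X_0^\bullet]\to\mathrm{Ab}$ be the functor with $\mathbb{Z}[x_0](x_0)=\mathbb{Z}$ and $\mathbb{Z}[x_0](*)=0$. Write $\varinjlim_n^{\mathfrak{Cat}_*[X_0^\bullet]}$ for the $n$-th left derived functor of $\varinjlim:\mathrm{Ab}^{\mathfrak{Cat}_*[X_0^\bullet]}\to\mathrm{Ab}$. Let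 $(E,\mathfrak{M})$ be the simplicial complex with vertex set $E$ whose simplices are the nonempty finite sets of mutually commuting generators, i.e. the nonempty $S\subseteq E$ with $(a,b)\in I$ for all distinct $a,b\in S$. Fix any linear order on $E$, and let $\widetilde H_k(E,\mathfrak{M})$, $k\ge 0$, be the reduced integral homology of this complex, i.e. the homology at $C_k$ of the augmented complex $\cdots\to C_1\to C_0\xrightarrow{\varepsilon}\mathbb{Z}\to 0$, where $C_k$ is the free abelian group on the $k$-simplices $[e_0<\dots<e_k]$, the boundary is $[e_0,\dots,e_k]\mapsto\sum_i(-1)^i[e_0,\dots,\widehat{e_i},\dots,e_k]$, and $\varepsilon$ sends every vertex to $1$. Then for every $n\ge 1$ there is an isomorphism of abelian groups $$\varinjlim\nolimits_n^{\mathfrak{Cat}_*[X_0^\bullet]}\mathbb{Z}[x_0]\;\cong\;\widetilde H_{n-1}(E,\mathfrak{M}).$$ -/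

import Mathlib

open CategoryTheory CategoryTheory.Limits

universe u

/-! ### Derived functors of the colimit -/

instance addCommGrpCat_enoughProjectives : EnoughProjectives AddCommGrpCat.{u} :=
  ((forget₂ (ModuleCat.{u} ℤ) AddCommGrpCat.{u}).asEquivalence.enoughProjectives_iff).1
    inferInstance

/-- The category of functors from a small category to abelian groups has enough projectives. -/
instance functorAddCommGrpCat_enoughProjectives (C : Type u) [SmallCategory C] :
    EnoughProjectives (C ⥤ AddCommGrpCat.{u}) where
  presentation F := by
    let P : C → (C ⥤ AddCommGrpCat.{u}) := fun c =>
      (evaluationLeftAdjoint AddCommGrpCat.{u} c).obj (Projective.over (F.obj c))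
    have hP : ∀ c, Projective (P c) := fun c =>
      (evaluationAdjunctionRight AddCommGrpCat.{u} c).map_projective _ inferInstance
    let q : ∀ c, P c ⟶ F := fun c =>
      ((evaluationAdjunctionRight AddCommGrpCat.{u} c).homEquiv _ _).symm
        (Projective.π (F.obj c))
    have hepi : Epi (Sigma.desc q) := by
      rw [NatTrans.epi_iff_epi_app]
      intro c
      have h : ((evaluationAdjunctionRight AddCommGrpCat.{u} c).homEquiv _ _ (q c)) =
          Projective.π (F.obj c) := Equiv.apply_symm_apply _ _
      rw [Adjunction.homEquiv_unit] at h
      have h2 : (q c).app c = (Sigma.ι P c).app c ≫ (Sigma.desc q).app c := by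
        rw [← NatTrans.comp_app, Sigma.ι_desc]
      have h3 : ((evaluationAdjunctionRight AddCommGrpCat.{u} c).unit.app _ ≫
          (Sigma.ι P c).app c) ≫ (Sigma.desc q).app c = Projective.π (F.obj c) := by
        rw [Category.assoc, ← h2]
        exact h
      exact @epi_of_epi_fac _ _ _ _ _ _ _ _ inferInstance h3
    exact ⟨{ p := ∐ P, f := Sigma.desc q, epi := hepi }⟩

/-- The `n`-th left derived functor of the colimit, evaluated at `F : C ⥤ Ab`. -/
noncomputable def derivedColim {C : Type u} [SmallCategory C] (n : ℕ)
    (F : C ⥤ AddCommGrpCat.{u}) : AddCommGrpCat.{u} :=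
  ((colim (J := C) (C := AddCommGrpCat.{u})).leftDerived n).obj F

/-! ### Free partially commutative monoids and pointed right sets over them -/

/-- The relations `ab = ba` for `(a, b) ∈ I`. -/
inductive CommutationRel {E : Type u} (I : E → E → Prop) : FreeMonoid E → FreeMonoid E → Prop
  | comm (a b : E) (h : I a b) :
      CommutationRel I (FreeMonoid.of a * FreeMonoid.of b) (FreeMonoid.of b * FreeMonoid.of a)

/-- The free partially commutative monoid `M(E, I)`. -/
abbrev PartiallyCommMonoid {E : Type u} (I : E → E → Prop) : Type u :=
  PresentedMonoid (CommutationRel I)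

/-- The category `𝔆𝔞𝔱_*[M, X]` of a right `M`-set `X` (a left action of the opposite monoid, so
that `x · μ` is `MulOpposite.op μ • x`): its objects are the elements of `X`, a morphism `x ⟶ x'`
is a `μ` in `M` with `x · μ = x'`, and the composite of `x --μ--> x'` and `x' --μ'--> x''` is
`x --μ * μ'--> x''`. -/
abbrev RightActionCategory (M : Type u) [Monoid M] (X : Type u) [MulAction Mᵐᵒᵖ X] : Type u :=
  ActionCategory Mᵐᵒᵖ X

open Classical in
/-- The functor on the category of a pointed right `M`-set `(X, pt)` with value `ℤ` at every
element other than `pt` and value `0` at `pt`; a morphism with target other than `pt` (hence also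
with source other than `pt`) goes to the identity of `ℤ`, every other morphism to `0`.
(`ℤ` is lifted to the universe `u`; its subgroup `{z | x = pt → z = 0}` is all of it
if `x ≠ pt`, and is zero if `x = pt`.) -/
noncomputable def pointedCoeff (M : Type u) [Monoid M] {X : Type u} [MulAction Mᵐᵒᵖ X] (pt : X)
    (hpt : ∀ μ : M, MulOpposite.op μ • pt = pt) :
    RightActionCategory M X ⥤ AddCommGrpCat.{u} where
  obj x := AddCommGrpCat.of
    { carrier := {z : ULift.{u} ℤ | x.back = pt → z = 0}
      add_mem' := fun {a b} ha hb h => by simp [ha h, hb h]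
      zero_mem' := fun _ => rfl
      neg_mem' := fun {a} ha h => by simp [ha h] : AddSubgroup (ULift.{u} ℤ) }
  map {x y} f := AddCommGrpCat.ofHom
    { toFun := fun z => ⟨if y.back = pt then 0 else z.1, fun h => if_pos h⟩
      map_zero' := by ext; simp
      map_add' := fun a b => by
        apply Subtype.ext
        by_cases h : y.back = pt <;> simp [h] }
  map_id x := by
    ext z
    by_cases h : x.back = pt
    · have hz : z.1 = 0 := z.2 h
      simp [h, hz]
    · simp [h]
  map_comp {x y z} f g := by
    ext w
    by_cases h : z.back = pt
    · simp [h]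
    · have hy : y.back ≠ pt := by
        intro hy
        have h1 : g.1 • y.back = z.back := g.2
        rw [hy] at h1
        exact h (h1.symm.trans (hpt (MulOpposite.unop g.1)))
      simp [h, hy]

/-! ### Reduced homology of a simplicial complex -/

namespace AbstractSimplicialComplex

variable {E : Type u} (K : AbstractSimplicialComplex E)

/-- The `n`-simplices: the faces with `n + 1` vertices. -/
abbrev Simplex (n : ℕ) : Type u := {s : Finset E // s ∈ K ∧ s.card = n + 1}

variable [LinearOrder E]

/-- The face of a simplex opposite to one of its vertices. -/
def Simplex.face {K : AbstractSimplicialComplex E} {n : ℕ} (s : K.Simplex (n + 1))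
    (v : {v : E // v ∈ s.1}) : K.Simplex n :=
  ⟨s.1.erase v.1, by
    have hc : (s.1.erase v.1).card = n + 1 := by
      rw [Finset.card_erase_of_mem v.2, s.2.2]; rfl
    exact ⟨(K.isRelLowerSet_faces s.2.1).2 (Finset.erase_subset _ _)
      (Finset.card_pos.1 (by omega)), hc⟩⟩

/-- The position (counted from `0`) of the vertex `v` in the increasing list of the vertices
of `s`. -/
def vertexIndex (s : Finset E) (v : E) : ℕ := (s.filter (· < v)).card

/-- The simplicial boundary `[e₀ < ⋯ < eₙ₊₁] ↦ ∑ᵢ (-1)ⁱ [e₀, …, êᵢ, …, eₙ₊₁]`. -/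
noncomputable def boundary (n : ℕ) : (K.Simplex (n + 1) →₀ ℤ) →ₗ[ℤ] (K.Simplex n →₀ ℤ) :=
  Finsupp.linearCombination ℤ fun s : K.Simplex (n + 1) =>
    ∑ v : {v : E // v ∈ s.1}, (-1 : ℤ) ^ vertexIndex s.1 v.1 • Finsupp.single (s.face v) (1 : ℤ)

/-- The augmentation, sending every vertex to `1`. -/
noncomputable def augmentation : (K.Simplex 0 →₀ ℤ) →ₗ[ℤ] ULift.{u} ℤ :=
  Finsupp.linearCombination ℤ fun _ => ULift.up (1 : ℤ)

theorem vertexIndex_erase_sign {s : Finset E} {v w : E} (hv : v ∈ s) (hw : w ∈ s) (h : v ≠ w) :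
    (-1 : ℤ) ^ vertexIndex s v * (-1) ^ vertexIndex (s.erase v) w +
      (-1 : ℤ) ^ vertexIndex s w * (-1) ^ vertexIndex (s.erase w) v = 0 := by
  wlog hlt : v < w generalizing v w
  · rw [add_comm]
    exact this hw hv h.symm (lt_of_le_of_ne (not_lt.1 hlt) h.symm)
  have h1 : vertexIndex (s.erase w) v = vertexIndex s v := by
    unfold vertexIndex
    rw [Finset.filter_erase, Finset.erase_eq_of_notMem]
    simp [hlt.le]
  have h2 : vertexIndex (s.erase v) w + 1 = vertexIndex s w := by
    unfold vertexIndex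
    rw [Finset.filter_erase]
    exact Finset.card_erase_add_one (by simp [hv, hlt])
  rw [h1, ← h2, pow_succ]
  ring

theorem boundary_single {n : ℕ} (s : K.Simplex (n + 1)) :
    K.boundary n (Finsupp.single s 1) =
      ∑ v : {v : E // v ∈ s.1},
        (-1 : ℤ) ^ vertexIndex s.1 v.1 • Finsupp.single (s.face v) (1 : ℤ) := by
  simp [boundary, Finsupp.linearCombination_single]

theorem boundary_comp_boundary (n : ℕ) : K.boundary n ∘ₗ K.boundary (n + 1) = 0 := by
  refine Finsupp.lhom_ext' fun s => LinearMap.ext_ring ?_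
  simp only [LinearMap.comp_apply, Finsupp.lsingle_apply, LinearMap.zero_apply]
  rw [boundary_single, map_sum]
  simp only [map_smul, boundary_single, Finset.smul_sum, smul_smul]
  rw [Finset.sum_sigma']
  refine Finset.sum_involution
    (fun p _ => ⟨⟨p.2.1, Finset.mem_of_mem_erase p.2.2⟩, ⟨p.1.1, Finset.mem_erase.2
      ⟨(Finset.ne_of_mem_erase p.2.2).symm, p.1.2⟩⟩⟩) ?_ ?_ ?_ ?_
  · rintro ⟨⟨v, hv⟩, ⟨w, hw⟩⟩ -
    have hf : (s.face ⟨v, hv⟩).face ⟨w, hw⟩ =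
        (s.face ⟨w, Finset.mem_of_mem_erase hw⟩).face ⟨v, Finset.mem_erase.2
          ⟨(Finset.ne_of_mem_erase hw).symm, hv⟩⟩ :=
      Subtype.ext (Finset.erase_right_comm)
    dsimp only
    rw [hf, ← add_smul]
    have := vertexIndex_erase_sign hv (Finset.mem_of_mem_erase hw)
      (Finset.ne_of_mem_erase hw).symm
    simp only [Simplex.face]
    rw [this, zero_smul]
  · rintro ⟨⟨v, hv⟩, ⟨w, hw⟩⟩ - - heq
    have h1 : w = v := congrArg (fun p => p.1.1) heq
    exact Finset.ne_of_mem_erase hw h1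
  · intro p _
    exact Finset.mem_univ _
  · rintro ⟨⟨v, hv⟩, ⟨w, hw⟩⟩ -
    rfl

theorem augmentation_comp_boundary : K.augmentation ∘ₗ K.boundary 0 = 0 := by
  refine Finsupp.lhom_ext' fun s => LinearMap.ext_ring ?_
  simp only [LinearMap.comp_apply, Finsupp.lsingle_apply, LinearMap.zero_apply]
  rw [boundary_single, map_sum]
  simp only [map_smul, augmentation, Finsupp.linearCombination_single, one_smul]
  rw [← Finset.sum_smul,
    Finset.sum_coe_sort s.1 (fun v => (-1 : ℤ) ^ vertexIndex s.1 v)]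
  obtain ⟨a, b, hab, hs⟩ := Finset.card_eq_two.1 s.2.2
  have h := vertexIndex_erase_sign (s := s.1) (v := a) (w := b) (by simp [hs]) (by simp [hs]) hab
  have ha : vertexIndex (s.1.erase a) b = 0 := by
    simp [hs, vertexIndex, Finset.filter_singleton, hab]
  have hb : vertexIndex (s.1.erase b) a = 0 := by
    have : ({a, b} : Finset E).erase b = {a} := by
      rw [Finset.pair_comm]; exact Finset.erase_insert (by simpa using hab.symm)
    simp [hs, vertexIndex, this, Finset.filter_singleton]
  rw [ha, hb] at h
  simp only [pow_zero, mul_one] at h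
  rw [hs, Finset.sum_pair hab, ← hs, h, zero_smul]

/-- The simplicial chain complex with integer coefficients; `n`-chains are the formal integer
combinations of the `n`-simplices. -/
noncomputable def chainComplex : ChainComplex AddCommGrpCat.{u} ℕ :=
  ChainComplex.of (fun n => AddCommGrpCat.of (K.Simplex n →₀ ℤ))
    (fun n => AddCommGrpCat.ofHom (K.boundary n).toAddMonoidHom) fun n => by
      ext1
      exact congrArg LinearMap.toAddMonoidHom (K.boundary_comp_boundary n)

theorem chainComplex_d_comp_augmentation :
    K.chainComplex.d 1 0 ≫ AddCommGrpCat.ofHom K.augmentation.toAddMonoidHom = 0 := by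
  have h : K.chainComplex.d 1 0 = AddCommGrpCat.ofHom (K.boundary 0).toAddMonoidHom :=
    ChainComplex.of_d (fun n => AddCommGrpCat.of (K.Simplex n →₀ ℤ))
      (fun n => AddCommGrpCat.ofHom (K.boundary n).toAddMonoidHom) 0
  rw [h]
  ext1
  exact congrArg LinearMap.toAddMonoidHom K.augmentation_comp_boundary

/-- The augmented chain complex `⋯ → C₁ → C₀ → ℤ → 0`, with `ℤ` in degree `0` and
`Cₙ` in degree `n + 1`. -/
noncomputable def augmentedChainComplex : ChainComplex AddCommGrpCat.{u} ℕ :=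
  K.chainComplex.augment (AddCommGrpCat.ofHom K.augmentation.toAddMonoidHom)
    K.chainComplex_d_comp_augmentation

/-- The reduced simplicial homology group `H̃ₙ(K)`, for `n ≥ 0`. -/
noncomputable def reducedHomology (n : ℕ) : AddCommGrpCat.{u} :=
  K.augmentedChainComplex.homology (n + 1)

end AbstractSimplicialComplex

/-- The simplicial complex `(E, 𝔐)`: its simplices are the nonempty finite sets of mutually
commuting generators. -/
def commutingComplex {E : Type u} (I : E → E → Prop) : AbstractSimplicialComplex E where
  faces := {s | s.Nonempty ∧ (s : Set E).Pairwise I}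
  isRelLowerSet_faces := fun _ hs =>
    ⟨hs.1, fun _ hts ht => ⟨ht, hs.2.mono (Finset.coe_subset.2 hts)⟩⟩
  singleton_mem v := ⟨Finset.singleton_nonempty v, by simp⟩

/-! The derived functors are computed from an explicit projective resolution of $\mathbb Z[x_0]$
whose colimit is the augmented simplicial chain complex itself.

In degree $n$ the resolution sends $x$ to the free abelian group on pairs $(w,S)$ with $x_0\cdot
w=x$ and $S$ a set of $n$ generators, each a left divisor of $w$. The differential deletes elements
of $S$ with alternating signs; morphisms multiply $w$ on the right. Two facts about left
divisibility in $M(E,I)$ carry the argument. Distinct generators dividing a common element commute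
(`comm_of_dvd_of_dvd`), and a commuting set $S$ has a common multiple $p_S$ through which every
common multiple factors uniquely (`exists_lcm_of_pairwise`). Hence the degree $n$ term is the direct
sum, over commuting sets $S$ of size $n$, of the free functors on the representables at $x_0\cdot
p_S$. It is therefore projective (`projective_freeFunctor`), with colimit free on those sets
(`isColimitCommutingSetCocone`).

Exactness is checked object by object. Over $*$ every $w$ differs from $1$, so it has a left divisor
$v(w)\in E$. For fixed $w$ the sets $S$ are all finite subsets of the divisors of $w$, and coning
with $v(w)$ contracts the complex. Over $x_0$ only $w=1$, $S=\emptyset$ occurs, which gives $\mathbb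
Z$ in degree $0$. In the colimit the empty set occupies degree $0$ and the $k$-simplices degree
$k+1$, which accounts for the shift from $n$ to $n-1$. -/

namespace PartiallyCommMonoid

/-! ### Left divisibility by generators in $M(E,I)$. -/

variable {E : Type u} {I : E → E → Prop}

local notation "γ" => PresentedMonoid.of (CommutationRel I)

theorem of_mul_of_comm {a b : E} (h : I a b) : γ a * γ b = γ b * γ a :=
  PresentedMonoid.mk_eq_mk_of_rel (CommutationRel.comm a b h)

@[elab_as_elim]
theorem induction_left {p : PartiallyCommMonoid I → Prop} (w : PartiallyCommMonoid I)
    (one : p 1) (mul : ∀ e w, p w → p (γ e * w)) : p w := by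
  induction w using PresentedMonoid.inductionOn with | _ l
  induction l using FreeMonoid.inductionOn' with
  | one => exact one
  | of_mul a l ih => exact mul a _ ih

open Classical in
/-- Left multiplication by the generator `b` on pairs consisting of an element `m` and of the
quotient of `m` by the generator `a` on the left, if there is one. -/
noncomputable def quotientStep (a b : E) :
    Function.End (PartiallyCommMonoid I × Option (PartiallyCommMonoid I)) :=
  fun z => (γ b * z.1, if b = a then some z.1 else if I a b then z.2.map (γ b * ·) else none)

/-- This is the relation needed for the steps to define an action of the monoid. Symmetry of `I`
enters when `c = a`: pushing `b` past the extracted `a` then needs `I a b`. -/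
theorem quotientStep_comm (hsymm : ∀ a b, I a b → I b a) (a : E) {b c : E} (h : I b c) :
    quotientStep (I := I) a b * quotientStep a c = quotientStep a c * quotientStep a b := by
  have hm := of_mul_of_comm h
  have hm' (m) : γ b * (γ c * m) = γ c * (γ b * m) := by rw [← mul_assoc, hm, mul_assoc]
  funext ⟨m, o⟩
  change quotientStep a b (quotientStep a c (m, o)) = quotientStep a c (quotientStep a b (m, o))
  simp only [quotientStep, hm']
  refine congrArg (Prod.mk _) ?_
  have h' := hsymm _ _ h
  rcases o with _ | o <;> grind

/-- The action of the partially commutative monoid on pairs consisting of an element `m` and of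
the quotient of `m` by the generator `a` on the left. -/
noncomputable def quotientAction (hsymm : ∀ a b, I a b → I b a) (a : E) :
    PartiallyCommMonoid I →*
      Function.End (PartiallyCommMonoid I × Option (PartiallyCommMonoid I)) :=
  PresentedMonoid.lift (quotientStep a) (by
    rintro _ _ ⟨b, c, h⟩
    simpa using quotientStep_comm hsymm a h)

theorem quotientAction_one_apply (hsymm : ∀ a b, I a b → I b a) (a : E)
    (z : PartiallyCommMonoid I × Option (PartiallyCommMonoid I)) :
    quotientAction hsymm a 1 z = z := by
  rw [map_one]
  rfl

theorem quotientAction_of_mul_apply (hsymm : ∀ a b, I a b → I b a) (a b : E)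
    (w : PartiallyCommMonoid I) (z : PartiallyCommMonoid I × Option (PartiallyCommMonoid I)) :
    quotientAction hsymm a (γ b * w) z = quotientStep a b (quotientAction hsymm a w z) := by
  rw [map_mul]
  rfl

/-- The quotient of `w` by the generator `a` on the left, if there is one. -/
noncomputable def leftQuotient (hsymm : ∀ a b, I a b → I b a) (a : E)
    (w : PartiallyCommMonoid I) : Option (PartiallyCommMonoid I) :=
  (quotientAction hsymm a w (1, none)).2

/-- The first coordinate only records the element read so far. The second needs it, since the
quotient of $aw$ by $a$ is $w$ itself. -/
theorem quotientAction_fst (hsymm : ∀ a b, I a b → I b a) (a : E) (w : PartiallyCommMonoid I) :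
    (quotientAction hsymm a w (1, none)).1 = w := by
  induction w using induction_left with
  | one => rw [quotientAction_one_apply]
  | mul e w ih =>
    rw [quotientAction_of_mul_apply]
    exact congrArg (γ e * ·) ih

theorem leftQuotient_one (hsymm : ∀ a b, I a b → I b a) (a : E) :
    leftQuotient hsymm a 1 = none := by
  rw [leftQuotient, quotientAction_one_apply]

open Classical in
theorem leftQuotient_of_mul (hsymm : ∀ a b, I a b → I b a) (a b : E)
    (w : PartiallyCommMonoid I) :
    leftQuotient hsymm a (γ b * w) = if b = a then some w else
      if I a b then (leftQuotient hsymm a w).map (γ b * ·) else none := by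
  rw [leftQuotient, quotientAction_of_mul_apply]
  simp only [quotientStep, quotientAction_fst, leftQuotient]

theorem leftQuotient_of_mul_self (hsymm : ∀ a b, I a b → I b a) (a : E)
    (w : PartiallyCommMonoid I) : leftQuotient hsymm a (γ a * w) = some w := by
  rw [leftQuotient_of_mul, if_pos rfl]

theorem of_mul_left_cancel (hsymm : ∀ a b, I a b → I b a) {a : E} {v w : PartiallyCommMonoid I}
    (h : γ a * v = γ a * w) : v = w := by
  have := congrArg (leftQuotient hsymm a) h
  simpa only [leftQuotient_of_mul_self, Option.some.injEq] using this

/-- Take the left quotient by `a` on both sides. On the left it is `some v`; on the right it exists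
only if `a` and `b` commute, and then it is a multiple of `b`. -/
theorem comm_of_of_mul_eq (hsymm : ∀ a b, I a b → I b a) {a b : E} (hab : a ≠ b)
    {v w : PartiallyCommMonoid I} (h : γ a * v = γ b * w) : I a b ∧ γ b ∣ v := by
  have := congrArg (leftQuotient hsymm a) h
  rw [leftQuotient_of_mul_self, leftQuotient_of_mul, if_neg hab.symm] at this
  split_ifs at this with h2
  obtain ⟨q, hq, hv⟩ := Option.map_eq_some_iff.1 this.symm
  exact ⟨h2, q, hv.symm⟩

/-- Distinct generators dividing an element on the left commute. -/
theorem comm_of_dvd_of_dvd (hsymm : ∀ a b, I a b → I b a) {a b : E} (hab : a ≠ b)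
    {w : PartiallyCommMonoid I} (ha : γ a ∣ w) (hb : γ b ∣ w) : I a b := by
  obtain ⟨v, rfl⟩ := ha
  obtain ⟨v', h⟩ := hb
  exact (comm_of_of_mul_eq hsymm hab h).1

theorem exists_of_dvd {w : PartiallyCommMonoid I} (hw : w ≠ 1) : ∃ e : E, γ e ∣ w := by
  induction w using induction_left with
  | one => exact absurd rfl hw
  | mul e w _ => exact ⟨e, dvd_mul_right _ _⟩

/-- A finite set of mutually commuting generators has a least common right multiple. -/
theorem exists_lcm_of_pairwise (hsymm : ∀ a b, I a b → I b a) (S : Finset E)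
    (hS : (S : Set E).Pairwise I) :
    ∃ p : PartiallyCommMonoid I, (∀ e ∈ S, γ e ∣ p) ∧
      ∀ w, (∀ e ∈ S, γ e ∣ w) → ∃! m, p * m = w := by
  classical
  induction S using Finset.induction_on with
  | empty => exact ⟨1, by simp, fun w _ => ⟨w, by simp, by simp⟩⟩
  | insert a S ha ih =>
    obtain ⟨p, hp, hw⟩ := ih (hS.mono (by simp))
    refine ⟨γ a * p, ?_, ?_⟩
    · intro e he
      rcases Finset.mem_insert.1 he with rfl | he'
      · exact dvd_mul_right _ _
      · obtain ⟨q, rfl⟩ := hp e he'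
        have : I a e := hS (by simp) (by simp [he']) (fun h => ha (h ▸ he'))
        rw [← mul_assoc, of_mul_of_comm this, mul_assoc]
        exact dvd_mul_right _ _
    -- Split off `a`, so that $w=av$. By `comm_of_of_mul_eq` the other generators still divide $v$,
    -- so the induction hypothesis applies to $v$; cancelling `a` gives uniqueness.
    · intro w h
      obtain ⟨v, rfl⟩ := h a (Finset.mem_insert_self _ _)
      obtain ⟨m, hm, huniq⟩ := hw v fun e he => by
        obtain ⟨q, hq⟩ := h e (Finset.mem_insert_of_mem he)
        exact (comm_of_of_mul_eq hsymm (fun h => ha (by rwa [h])) hq).2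
      refine ⟨m, by simp only [← hm, mul_assoc], fun m' hm' => huniq m' ?_⟩
      replace hm' : γ a * p * m' = γ a * v := hm'
      rw [mul_assoc] at hm'
      exact of_mul_left_cancel hsymm hm'

end PartiallyCommMonoid

/-! ### The complex of cells over one element, and its contraction. -/

/-- A pair of an element `w` of the monoid with `x₀ · w = y` and of a set of `n` generators, each
of which divides `w` on the left. -/
@[ext]
structure DivisorCell {E : Type u} (I : E → E → Prop) {X : Type u}
    [MulAction (PartiallyCommMonoid I)ᵐᵒᵖ X] (x₀ : X) (n : ℕ) (y : X) : Type u where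
  /-- the element of the monoid -/
  elt : PartiallyCommMonoid I
  /-- the set of generators -/
  gens : Finset E
  smul_eq : MulOpposite.op elt • x₀ = y
  card_eq : gens.card = n
  dvd : ∀ e ∈ gens, PresentedMonoid.of (CommutationRel I) e ∣ elt

namespace DivisorCell

open AbstractSimplicialComplex

variable {E : Type u} {I : E → E → Prop} {X : Type u}
  [MulAction (PartiallyCommMonoid I)ᵐᵒᵖ X] {x₀ y : X} {n : ℕ}

local notation "γ" => PresentedMonoid.of (CommutationRel I)

open Classical in
/-- The basis element given by a pair, and `0` if the pair is not a cell. -/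
noncomputable def single (x₀ y : X) (n : ℕ) (w : PartiallyCommMonoid I) (S : Finset E) :
    FreeAbelianGroup (DivisorCell I x₀ n y) :=
  if h : MulOpposite.op w • x₀ = y ∧ S.card = n ∧ ∀ e ∈ S, γ e ∣ w then
    FreeAbelianGroup.of ⟨w, S, h.1, h.2.1, h.2.2⟩ else 0

theorem single_elt_gens (c : DivisorCell I x₀ n y) :
    single x₀ y n c.elt c.gens = FreeAbelianGroup.of c :=
  dif_pos ⟨c.smul_eq, c.card_eq, c.dvd⟩

theorem single_of_smul_ne {w : PartiallyCommMonoid I} (h : MulOpposite.op w • x₀ ≠ y)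
    (S : Finset E) : single x₀ y n w S = 0 :=
  dif_neg fun h' => h h'.1

theorem single_of_card_ne (w : PartiallyCommMonoid I) {S : Finset E} (h : S.card ≠ n) :
    single x₀ y n w S = 0 :=
  dif_neg fun h' => h h'.2.1

variable [LinearOrder E]

/-- The differential `(w, S) ↦ ∑ᵢ (-1)ⁱ (w, S \ {eᵢ})`. -/
noncomputable def differential (x₀ y : X) (n : ℕ) :
    FreeAbelianGroup (DivisorCell I x₀ (n + 1) y) →+ FreeAbelianGroup (DivisorCell I x₀ n y) :=
  FreeAbelianGroup.lift fun c =>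
    ∑ v ∈ c.gens, (-1 : ℤ) ^ vertexIndex c.gens v • single x₀ y n c.elt (c.gens.erase v)

theorem differential_of (c : DivisorCell I x₀ (n + 1) y) :
    differential x₀ y n (FreeAbelianGroup.of c) =
      ∑ v ∈ c.gens, (-1 : ℤ) ^ vertexIndex c.gens v • single x₀ y n c.elt (c.gens.erase v) :=
  FreeAbelianGroup.lift_apply_of _ _

/-- The default value `0` of `single` is harmless here: if `w` does not lead to `y`, or `S` has the
wrong size, every term on both sides vanishes. -/
theorem differential_single {w : PartiallyCommMonoid I} {S : Finset E} (hS : ∀ e ∈ S, γ e ∣ w) :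
    differential x₀ y n (single x₀ y (n + 1) w S) =
      ∑ v ∈ S, (-1 : ℤ) ^ vertexIndex S v • single x₀ y n w (S.erase v) := by
  by_cases h : MulOpposite.op w • x₀ = y
  · by_cases hc : S.card = n + 1
    · exact (congrArg _ (single_elt_gens ⟨w, S, h, hc, hS⟩)).trans (differential_of _)
    · rw [single_of_card_ne _ hc, map_zero]
      refine (Finset.sum_eq_zero fun v hv => ?_).symm
      rw [single_of_card_ne, smul_zero]
      have := Finset.card_erase_add_one hv
      omega
  · simp only [single_of_smul_ne h, map_zero, smul_zero, Finset.sum_const_zero]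

theorem differential_differential (z : FreeAbelianGroup (DivisorCell I x₀ (n + 2) y)) :
    differential x₀ y n (differential x₀ y (n + 1) z) = 0 := by
  refine DFunLike.congr_fun (f := (differential x₀ y n).comp (differential x₀ y (n + 1)))
    (g := 0) (FreeAbelianGroup.lift_ext _ _ fun c => ?_) z
  rw [AddMonoidHom.comp_apply, differential_of, map_sum, AddMonoidHom.zero_apply]
  have h (v) : differential x₀ y n ((-1 : ℤ) ^ vertexIndex c.gens v •
      single x₀ y (n + 1) c.elt (c.gens.erase v)) = ∑ u ∈ c.gens.erase v,
        ((-1 : ℤ) ^ vertexIndex c.gens v * (-1) ^ vertexIndex (c.gens.erase v) u) •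
          single x₀ y n c.elt ((c.gens.erase v).erase u) := by
    rw [map_zsmul, differential_single fun e he => c.dvd e (Finset.mem_of_mem_erase he),
      Finset.smul_sum]
    simp only [smul_smul]
  simp only [h]
  rw [Finset.sum_sigma']
  -- Deleting the same two elements in the opposite order gives the same cell with opposite sign.
  refine Finset.sum_involution (fun p _ => ⟨p.2, p.1⟩) ?_ ?_ ?_ ?_
  · rintro ⟨v, w⟩ hp
    simp only [Finset.mem_sigma, Finset.mem_erase] at hp
    rw [Finset.erase_right_comm, ← add_smul,
      vertexIndex_erase_sign hp.1 hp.2.2 hp.2.1.symm, zero_smul]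
  · rintro ⟨v, w⟩ hp - heq
    simp only [Finset.mem_sigma, Finset.mem_erase] at hp
    exact hp.2.1 (congrArg Sigma.fst heq)
  · rintro ⟨v, w⟩ hp
    simp only [Finset.mem_sigma, Finset.mem_erase] at hp ⊢
    exact ⟨hp.2.2, hp.2.1.symm, hp.1⟩
  · rintro ⟨v, w⟩ -
    rfl

/-- The homotopy `(w, S) ↦ ± (w, S ∪ {v w})`. -/
noncomputable def homotopy (v : PartiallyCommMonoid I → E) (x₀ y : X) (n : ℕ) :
    FreeAbelianGroup (DivisorCell I x₀ n y) →+ FreeAbelianGroup (DivisorCell I x₀ (n + 1) y) :=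
  FreeAbelianGroup.lift fun c => if v c.elt ∈ c.gens then 0 else
    (-1 : ℤ) ^ vertexIndex (insert (v c.elt) c.gens) (v c.elt) •
      single x₀ y (n + 1) c.elt (insert (v c.elt) c.gens)

theorem homotopy_of (v : PartiallyCommMonoid I → E) (c : DivisorCell I x₀ n y) :
    homotopy v x₀ y n (FreeAbelianGroup.of c) = if v c.elt ∈ c.gens then 0 else
      (-1 : ℤ) ^ vertexIndex (insert (v c.elt) c.gens) (v c.elt) •
        single x₀ y (n + 1) c.elt (insert (v c.elt) c.gens) :=
  FreeAbelianGroup.lift_apply_of _ _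

theorem homotopy_single (v : PartiallyCommMonoid I → E) {w : PartiallyCommMonoid I}
    {S : Finset E} (hS : ∀ e ∈ S, γ e ∣ w) :
    homotopy v x₀ y n (single x₀ y n w S) = if v w ∈ S then 0 else
      (-1 : ℤ) ^ vertexIndex (insert (v w) S) (v w) •
        single x₀ y (n + 1) w (insert (v w) S) := by
  by_cases h : MulOpposite.op w • x₀ = y
  · by_cases hc : S.card = n
    · exact (congrArg _ (single_elt_gens ⟨w, S, h, hc, hS⟩)).trans (homotopy_of _ _)
    · rw [single_of_card_ne _ hc, map_zero]
      split_ifs with hv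
      · rfl
      · rw [single_of_card_ne, smul_zero]
        rw [Finset.card_insert_of_notMem hv]
        omega
  · simp only [single_of_smul_ne h, map_zero, smul_zero, ite_self]

variable {v : PartiallyCommMonoid I → E}

/-- Every face except the one opposite the cone point still contains that point, so the homotopy
kills it. -/
theorem homotopy_differential_of_mem {c : DivisorCell I x₀ (n + 1) y} (h : v c.elt ∈ c.gens) :
    homotopy v x₀ y n (differential x₀ y n (FreeAbelianGroup.of c)) = FreeAbelianGroup.of c := by
  have hd (u) : ∀ e ∈ c.gens.erase u, γ e ∣ c.elt :=
    fun e he => c.dvd e (Finset.mem_of_mem_erase he)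
  rw [differential_of, map_sum, Finset.sum_eq_single_of_mem _ h]
  · rw [map_zsmul, homotopy_single v (hd _), if_neg (Finset.notMem_erase _ _),
      Finset.insert_erase h, smul_smul, ← mul_pow, single_elt_gens]
    simp
  · intro u hu hne
    rw [map_zsmul, homotopy_single v (hd _), if_pos (Finset.mem_erase.2 ⟨hne.symm, h⟩), smul_zero]

theorem differential_homotopy_of_notMem {c : DivisorCell I x₀ n y} (hv : γ (v c.elt) ∣ c.elt)
    (h : v c.elt ∉ c.gens) :
    differential x₀ y n (homotopy v x₀ y n (FreeAbelianGroup.of c)) = FreeAbelianGroup.of c +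
      ∑ u ∈ c.gens, ((-1 : ℤ) ^ vertexIndex (insert (v c.elt) c.gens) (v c.elt) *
        (-1) ^ vertexIndex (insert (v c.elt) c.gens) u) •
          single x₀ y n c.elt ((insert (v c.elt) c.gens).erase u) := by
  have hd : ∀ e ∈ insert (v c.elt) c.gens, γ e ∣ c.elt := fun e he => by
    rcases Finset.mem_insert.1 he with rfl | he
    exacts [hv, c.dvd e he]
  rw [homotopy_of, if_neg h, map_zsmul, differential_single hd, Finset.smul_sum,
    Finset.sum_insert h, Finset.erase_insert h, single_elt_gens, smul_smul, ← mul_pow]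
  simp only [smul_smul]
  simp

/-- The usual contraction of a cone. It works for each `w` separately because the differential
leaves `w`, hence the cone point `v w`, unchanged. -/
theorem differential_homotopy_add_homotopy_differential {c : DivisorCell I x₀ (n + 1) y}
    (hv : γ (v c.elt) ∣ c.elt) :
    differential x₀ y (n + 1) (homotopy v x₀ y (n + 1) (FreeAbelianGroup.of c)) +
      homotopy v x₀ y n (differential x₀ y n (FreeAbelianGroup.of c)) =
        FreeAbelianGroup.of c := by
  by_cases h : v c.elt ∈ c.gens
  · rw [homotopy_differential_of_mem h, homotopy_of, if_pos h, map_zero, zero_add]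
  · rw [differential_homotopy_of_notMem hv h, differential_of, map_sum, add_assoc,
      ← Finset.sum_add_distrib, Finset.sum_eq_zero, add_zero]
    intro u hu
    have hne : v c.elt ≠ u := fun h' => h (h' ▸ hu)
    rw [map_zsmul, homotopy_single v fun e he => c.dvd e (Finset.mem_of_mem_erase he),
      if_neg fun h' => h (Finset.mem_of_mem_erase h'), Finset.erase_insert_of_ne hne,
      smul_smul, ← add_smul]
    have := vertexIndex_erase_sign (Finset.mem_insert_self (v c.elt) c.gens)
      (Finset.mem_insert_of_mem hu) hne
    rw [Finset.erase_insert h, Finset.erase_insert_of_ne hne] at this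
    have hsq (k : ℕ) : ((-1 : ℤ) ^ k) * (-1) ^ k = 1 := by rw [← mul_pow]; simp
    convert zero_smul ℤ _
    -- The sign rule for deleting `v c.elt` and `u` in either order, multiplied by two of the signs
    -- involved; their squares are $1$.
    linear_combination (((-1 : ℤ) ^ vertexIndex (insert (v c.elt) c.gens) u) *
        (-1) ^ vertexIndex c.gens u) * this -
      ((-1 : ℤ) ^ vertexIndex (insert (v c.elt) c.gens) (v c.elt) *
        (-1) ^ vertexIndex (insert (v c.elt) c.gens) u) * hsq (vertexIndex c.gens u) -
      ((-1 : ℤ) ^ vertexIndex c.gens u *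
        (-1) ^ vertexIndex (insert (v c.elt) (c.gens.erase u)) (v c.elt)) *
          hsq (vertexIndex (insert (v c.elt) c.gens) u)

theorem differential_exact_of_dvd
    (hv : ∀ w, MulOpposite.op w • x₀ = y → γ (v w) ∣ w) :
    Function.Exact (differential (I := I) x₀ y (n + 1)) (differential x₀ y n) := by
  refine fun z => ⟨fun hz => ⟨homotopy v x₀ y (n + 1) z, ?_⟩, ?_⟩
  · have := DFunLike.congr_fun (f := (differential x₀ y (n + 1)).comp (homotopy v x₀ y (n + 1)) +
      (homotopy v x₀ y n).comp (differential x₀ y n)) (g := AddMonoidHom.id _)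
      (FreeAbelianGroup.lift_ext _ _ fun c =>
        differential_homotopy_add_homotopy_differential (hv _ c.smul_eq)) z
    simpa [hz] using this
  · rintro ⟨z, rfl⟩
    exact differential_differential z

/-- The contraction reaches degree $0$ because the empty set counts as a cell: the complex is that
of an augmented simplex. -/
theorem differential_surjective_of_dvd
    (hv : ∀ w, MulOpposite.op w • x₀ = y → γ (v w) ∣ w) :
    Function.Surjective (differential (I := I) x₀ y 0) := fun z => by
  refine ⟨homotopy v x₀ y 0 z, ?_⟩
  refine DFunLike.congr_fun (f := (differential x₀ y 0).comp (homotopy v x₀ y 0))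
    (g := AddMonoidHom.id _) (FreeAbelianGroup.lift_ext _ _ fun c => ?_) z
  have h : c.gens = ∅ := Finset.card_eq_zero.1 c.card_eq
  rw [AddMonoidHom.comp_apply, differential_homotopy_of_notMem (hv _ c.smul_eq) (by simp [h])]
  simp [h]

end DivisorCell

/-! ### Cells as sums of representables: projectivity and colimits. -/

/-- The sets of `n` mutually commuting generators. -/
abbrev CommutingSet {E : Type u} (I : E → E → Prop) (n : ℕ) : Type u :=
  {S : Finset E // S.card = n ∧ (S : Set E).Pairwise I}

namespace DivisorCell

open AbstractSimplicialComplex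

variable {E : Type u} {I : E → E → Prop} {X : Type u}
  [MulAction (PartiallyCommMonoid I)ᵐᵒᵖ X] {x₀ y z : X} {n : ℕ}

local notation "γ" => PresentedMonoid.of (CommutationRel I)

/-- Right translation of cells. -/
def translate (μ : (PartiallyCommMonoid I)ᵐᵒᵖ) (h : μ • y = z) (c : DivisorCell I x₀ n y) :
    DivisorCell I x₀ n z where
  elt := c.elt * μ.unop
  gens := c.gens
  smul_eq := by rw [MulOpposite.op_mul, MulOpposite.op_unop, mul_smul, c.smul_eq, h]
  card_eq := c.card_eq
  dvd e he := dvd_mul_of_dvd_left (c.dvd e he) _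

theorem map_translate_single (μ : (PartiallyCommMonoid I)ᵐᵒᵖ) (h : μ • y = z)
    {w : PartiallyCommMonoid I} (hw : MulOpposite.op w • x₀ = y) {S : Finset E}
    (hS : ∀ e ∈ S, γ e ∣ w) :
    FreeAbelianGroup.map (translate μ h) (single x₀ y n w S) =
      single x₀ z n (w * μ.unop) S := by
  by_cases hc : S.card = n
  · rw [show single x₀ y n w S = _ from single_elt_gens ⟨w, S, hw, hc, hS⟩,
      FreeAbelianGroup.map_of_apply, ← single_elt_gens]
    rfl
  · rw [single_of_card_ne _ hc, single_of_card_ne _ hc, map_zero]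

variable {x x' x'' : RightActionCategory (PartiallyCommMonoid I) X}

/-- The element of the monoid underlying a morphism. -/
def label (f : x ⟶ x') : (PartiallyCommMonoid I)ᵐᵒᵖ := f.1

theorem label_smul (f : x ⟶ x') : label f • x.back = x'.back := f.2

theorem hom_ext_label {f g : x ⟶ x'} (h : (label f).unop = (label g).unop) : f = g :=
  Subtype.ext (MulOpposite.unop_injective h)

/-- The action of a morphism on cells. -/
def push (f : x ⟶ x') (c : DivisorCell I x₀ n x.back) : DivisorCell I x₀ n x'.back :=
  translate (label f) (label_smul f) c

theorem push_id (c : DivisorCell I x₀ n x.back) : push (𝟙 x) c = c :=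
  DivisorCell.ext (mul_one c.elt) rfl

theorem push_comp (f : x ⟶ x') (g : x' ⟶ x'') (c : DivisorCell I x₀ n x.back) :
    push (f ≫ g) c = push g (push f c) :=
  DivisorCell.ext (mul_assoc c.elt (label f).unop (label g).unop).symm rfl

variable (I x₀ n) in
/-- The functor of free abelian groups on the cells. -/
noncomputable def freeFunctor :
    RightActionCategory (PartiallyCommMonoid I) X ⥤ AddCommGrpCat.{u} where
  obj x := AddCommGrpCat.of (FreeAbelianGroup (DivisorCell I x₀ n x.back))
  map f := AddCommGrpCat.ofHom (FreeAbelianGroup.map (push f))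
  map_id x := by
    ext1
    refine FreeAbelianGroup.lift_ext _ _ fun c => ?_
    exact (FreeAbelianGroup.map_of_apply c).trans (congrArg _ (push_id c))
  map_comp f g := by
    ext1
    refine FreeAbelianGroup.lift_ext _ _ fun c => ?_
    refine (FreeAbelianGroup.map_of_apply c).trans ?_
    rw [push_comp]
    simp

/-- The basis element of `freeFunctor` given by a cell. -/
noncomputable def basis (c : DivisorCell I x₀ n x.back) : (freeFunctor I x₀ n).obj x :=
  FreeAbelianGroup.of c

theorem freeFunctor_map_basis (f : x ⟶ x') (c : DivisorCell I x₀ n x.back) :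
    (freeFunctor I x₀ n).map f (basis c) = basis (push f c) :=
  FreeAbelianGroup.map_of_apply c

/-- Two morphisms out of a value of `freeFunctor` agree if they agree on cells. -/
theorem freeFunctor_obj_hom_ext {A : AddCommGrpCat.{u}} {f g : (freeFunctor I x₀ n).obj x ⟶ A}
    (h : ∀ c : DivisorCell I x₀ n x.back, f (basis c) = g (basis c)) : f = g := by
  ext1
  exact FreeAbelianGroup.lift_ext _ _ h

/-- The morphism out of a value of `freeFunctor` with given values on cells. -/
noncomputable def freeFunctorDesc {A : AddCommGrpCat.{u}} (φ : DivisorCell I x₀ n x.back → A) :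
    (freeFunctor I x₀ n).obj x ⟶ A :=
  AddCommGrpCat.ofHom (FreeAbelianGroup.lift φ)

theorem freeFunctorDesc_basis {A : AddCommGrpCat.{u}} (φ : DivisorCell I x₀ n x.back → A)
    (c : DivisorCell I x₀ n x.back) : freeFunctorDesc φ (basis c) = φ c :=
  FreeAbelianGroup.lift_apply_of _ _

/-- The set of generators of a cell is commuting. -/
def commutingSet (hsymm : ∀ a b, I a b → I b a) (c : DivisorCell I x₀ n y) : CommutingSet I n :=
  ⟨c.gens, c.card_eq, fun a ha b hb hab =>
    PartiallyCommMonoid.comm_of_dvd_of_dvd hsymm hab (c.dvd a ha) (c.dvd b hb)⟩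

/-- The least common multiple of a commuting set of generators. -/
noncomputable def lcm (hsymm : ∀ a b, I a b → I b a) (t : CommutingSet I n) :
    PartiallyCommMonoid I :=
  (PartiallyCommMonoid.exists_lcm_of_pairwise hsymm t.1 t.2.2).choose

variable (x₀) in
/-- The object of the category at which the universal cell on a commuting set lives. -/
noncomputable def universalObj (hsymm : ∀ a b, I a b → I b a) (t : CommutingSet I n) :
    RightActionCategory (PartiallyCommMonoid I) X :=
  ActionCategory.objEquiv _ _ (MulOpposite.op (lcm hsymm t) • x₀)

variable (x₀) in
/-- The universal cell on a commuting set. -/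
noncomputable def universalCell (hsymm : ∀ a b, I a b → I b a) (t : CommutingSet I n) :
    DivisorCell I x₀ n (universalObj x₀ hsymm t).back where
  elt := lcm hsymm t
  gens := t.1
  smul_eq := rfl
  card_eq := t.2.1
  dvd := (PartiallyCommMonoid.exists_lcm_of_pairwise hsymm t.1 t.2.2).choose_spec.1

/-- Unique factorisation of `c.elt` through the least common multiple says that cells with a given
set of generators form a representable functor. -/
theorem existsUnique_push_universalCell (hsymm : ∀ a b, I a b → I b a)
    (c : DivisorCell I x₀ n x.back) :
    ∃! f : universalObj x₀ hsymm (c.commutingSet hsymm) ⟶ x,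
      push f (universalCell x₀ hsymm (c.commutingSet hsymm)) = c := by
  obtain ⟨m, hm, huniq⟩ := (PartiallyCommMonoid.exists_lcm_of_pairwise hsymm
    (c.commutingSet hsymm).1 (c.commutingSet hsymm).2.2).choose_spec.2 c.elt c.dvd
  replace hm : lcm hsymm (c.commutingSet hsymm) * m = c.elt := hm
  have h : MulOpposite.op m • MulOpposite.op (lcm hsymm (c.commutingSet hsymm)) • x₀ = x.back := by
    rw [← mul_smul, ← MulOpposite.op_mul, hm, c.smul_eq]
  refine ⟨⟨MulOpposite.op m, h⟩, DivisorCell.ext hm rfl, fun f hf => hom_ext_label ?_⟩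
  exact huniq (label f).unop (congrArg DivisorCell.elt hf)

/-- The morphism which takes the universal cell to a given cell. -/
noncomputable def fromUniversal (hsymm : ∀ a b, I a b → I b a)
    (c : DivisorCell I x₀ n x.back) :
    universalObj x₀ hsymm (c.commutingSet hsymm) ⟶ x :=
  (existsUnique_push_universalCell hsymm c).choose

theorem push_fromUniversal (hsymm : ∀ a b, I a b → I b a) (c : DivisorCell I x₀ n x.back) :
    push (fromUniversal hsymm c) (universalCell x₀ hsymm (c.commutingSet hsymm)) = c :=
  (existsUnique_push_universalCell hsymm c).choose_spec.1

theorem fromUniversal_push (hsymm : ∀ a b, I a b → I b a) (f : x ⟶ x')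
    (c : DivisorCell I x₀ n x.back) :
    fromUniversal hsymm (push f c) = fromUniversal hsymm c ≫ f := by
  refine ((existsUnique_push_universalCell hsymm (push f c)).choose_spec.2 _ ?_).symm
  exact (push_comp _ _ _).trans (congrArg (push f) (push_fromUniversal hsymm c))

theorem projective_freeFunctor (hsymm : ∀ a b, I a b → I b a) :
    Projective (freeFunctor I x₀ n) where
  factors {G H} f e _ := by
    have hs (x) : Function.Surjective (e.app x) :=
      (AddCommGrpCat.epi_iff_surjective _).1 inferInstance
    -- By Yoneda it is enough to lift the image of each universal cell; every other value is
    -- transported from these.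
    choose g hg using fun t : CommutingSet I n => hs (universalObj x₀ hsymm t)
      (f.app _ (basis (universalCell x₀ hsymm t)))
    refine ⟨{ app := fun x => freeFunctorDesc fun c => G.map (fromUniversal hsymm c) (g _)
              naturality := fun x x' f => freeFunctor_obj_hom_ext fun c => ?_ }, ?_⟩
    · rw [ConcreteCategory.comp_apply, ConcreteCategory.comp_apply, freeFunctor_map_basis,
        freeFunctorDesc_basis, freeFunctorDesc_basis]
      refine (congrArg (fun k : universalObj x₀ hsymm (c.commutingSet hsymm) ⟶ x' =>
        G.map k (g (c.commutingSet hsymm))) (fromUniversal_push hsymm f c)).trans ?_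
      rw [Functor.map_comp, ConcreteCategory.comp_apply]
    · ext1; funext x
      refine freeFunctor_obj_hom_ext fun c => ?_
      rw [NatTrans.comp_app, ConcreteCategory.comp_apply, freeFunctorDesc_basis,
        NatTrans.naturality_apply, hg, ← NatTrans.naturality_apply, freeFunctor_map_basis,
        push_fromUniversal]

/-- A cocone over `freeFunctor` whose point is free on the commuting sets, in such a way that every
cell is sent to the basis element of its set of generators. -/
noncomputable def commutingSetCocone (hsymm : ∀ a b, I a b → I b a) {A : AddCommGrpCat.{u}}
    (b : CommutingSet I n → A) : Cocone (freeFunctor I x₀ n) where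
  pt := A
  ι :=
    { app := fun x => freeFunctorDesc fun c => b (c.commutingSet hsymm)
      naturality := fun x x' f => freeFunctor_obj_hom_ext fun c => by
        rw [ConcreteCategory.comp_apply, ConcreteCategory.comp_apply, freeFunctor_map_basis,
          freeFunctorDesc_basis, freeFunctorDesc_basis]
        rfl }

theorem commutingSetCocone_app_basis (hsymm : ∀ a b, I a b → I b a) {A : AddCommGrpCat.{u}}
    (b : CommutingSet I n → A) (c : DivisorCell I x₀ n x.back) :
    (commutingSetCocone hsymm b).ι.app x (basis c) = b (c.commutingSet hsymm) :=
  freeFunctorDesc_basis _ _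

/-- The colimit of `freeFunctor` is free on the commuting sets. -/
noncomputable def isColimitCommutingSetCocone (hsymm : ∀ a b, I a b → I b a)
    {A : AddCommGrpCat.{u}} (b : CommutingSet I n → A)
    (hb : ∀ (B : AddCommGrpCat.{u}) (φ : CommutingSet I n → B), ∃! ψ : A ⟶ B, ∀ t, ψ (b t) = φ t) :
    IsColimit (commutingSetCocone (x₀ := x₀) hsymm b) where
  -- A cocone is determined by its values on universal cells. Only the universal property of `A` is
  -- used, so the simplicial chain groups can later serve as `A`.
  desc s := (hb s.pt fun t => s.ι.app _ (basis (universalCell x₀ hsymm t))).exists.choose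
  fac s x := freeFunctor_obj_hom_ext fun c => by
    change (hb _ _).exists.choose ((commutingSetCocone hsymm b).ι.app x (basis c)) = _
    rw [commutingSetCocone_app_basis,
      (hb s.pt fun t => s.ι.app _ (basis (universalCell x₀ hsymm t))).exists.choose_spec,
      ← s.w (fromUniversal hsymm c), ConcreteCategory.comp_apply, freeFunctor_map_basis,
      push_fromUniversal]
  uniq s m hm := by
    refine (hb s.pt fun t => s.ι.app _ (basis (universalCell x₀ hsymm t))).unique (fun t => ?_)
      (hb s.pt fun t => s.ι.app _ (basis (universalCell x₀ hsymm t))).exists.choose_spec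
    rw [← hm, ConcreteCategory.comp_apply, commutingSetCocone_app_basis]
    rfl

/-! ### The complex of functors. -/

section Resolution

variable [LinearOrder E]

variable (x₀ n x) in
/-- The differential as a morphism. -/
noncomputable def freeFunctorObjD :
    (freeFunctor I x₀ (n + 1)).obj x ⟶ (freeFunctor I x₀ n).obj x :=
  AddCommGrpCat.ofHom (differential x₀ x.back n)

variable (I x₀ n) in
/-- The differential as a natural transformation. -/
noncomputable def freeFunctorD : freeFunctor I x₀ (n + 1) ⟶ freeFunctor I x₀ n where
  app x := freeFunctorObjD x₀ n x
  naturality x x' f := freeFunctor_obj_hom_ext fun c => by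
    rw [ConcreteCategory.comp_apply, ConcreteCategory.comp_apply, freeFunctor_map_basis]
    refine (differential_of (push f c)).trans ?_
    refine .trans ?_ (congrArg (FreeAbelianGroup.map (push f)) (differential_of c)).symm
    rw [map_sum]
    refine Finset.sum_congr rfl fun v _ => ?_
    rw [map_zsmul]
    exact congrArg _ (map_translate_single (label f) (label_smul f) c.smul_eq
      fun e he => c.dvd e (Finset.mem_of_mem_erase he)).symm

/-- This form has no default values and is indexed like the simplicial boundary, for the comparison
with chains. -/
theorem freeFunctorD_app_basis (c : DivisorCell I x₀ (n + 1) x.back) :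
    (freeFunctorD I x₀ n).app x (basis c) =
      ∑ v : {v : E // v ∈ c.gens}, (-1 : ℤ) ^ vertexIndex c.gens v.1 • basis
        { elt := c.elt
          gens := c.gens.erase v.1
          smul_eq := c.smul_eq
          card_eq := by rw [Finset.card_erase_of_mem v.2, c.card_eq, Nat.add_sub_cancel]
          dvd := fun e he => c.dvd e (Finset.mem_of_mem_erase he) } := by
  refine (differential_of c).trans ?_
  rw [← Finset.sum_coe_sort]
  refine Finset.sum_congr rfl fun v _ => congrArg _ ?_
  exact single_elt_gens (n := n) ⟨_, _, _, _, _⟩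

variable (I x₀) in
/-- The chain complex of the functors `freeFunctor`. -/
noncomputable def freeComplex :
    ChainComplex (RightActionCategory (PartiallyCommMonoid I) X ⥤ AddCommGrpCat.{u}) ℕ :=
  ChainComplex.of (freeFunctor I x₀) (fun n => freeFunctorD I x₀ n) fun n => by
    ext1; funext x; ext1; ext z
    exact differential_differential _

theorem freeComplex_d : (freeComplex I x₀).d (n + 1) n = freeFunctorD I x₀ n :=
  ChainComplex.of_d (freeFunctor I x₀) (fun n => freeFunctorD I x₀ n) n

end Resolution

end DivisorCell

/-! ### Projective resolutions recognised pointwise. -/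

/-- Evaluation preserves homology, and a functor with zero values is zero. -/
theorem CategoryTheory.ShortComplex.exact_of_evaluation {J : Type u} [SmallCategory J]
    (S : ShortComplex (J ⥤ AddCommGrpCat.{u}))
    (h : ∀ j, (S.map ((evaluation J AddCommGrpCat.{u}).obj j)).Exact) : S.Exact := by
  rw [ShortComplex.exact_iff_isZero_homology]
  refine Functor.isZero _ fun j => ?_
  exact ((ShortComplex.exact_iff_isZero_homology _).1 (h j)).of_iso
    (S.mapHomologyIso ((evaluation J AddCommGrpCat.{u}).obj j)).symm

/-- A chain complex of functors with an augmentation which is pointwise exact is a projective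
resolution, provided that its terms are projective. -/
noncomputable def CategoryTheory.ProjectiveResolution.ofPointwiseExact {J : Type u}
    [SmallCategory J] {F : J ⥤ AddCommGrpCat.{u}} (K : ChainComplex (J ⥤ AddCommGrpCat.{u}) ℕ)
    (ε : K.X 0 ⟶ F) (hε : K.d 1 0 ≫ ε = 0) (hproj : ∀ n, Projective (K.X n))
    (hsurj : ∀ j, Function.Surjective (ε.app j))
    (hzero : ∀ j, Function.Exact ((K.d 1 0).app j) (ε.app j))
    (hsucc : ∀ n j, Function.Exact ((K.d (n + 2) (n + 1)).app j) ((K.d (n + 1) n).app j)) :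
    ProjectiveResolution F where
  complex := K
  projective := hproj
  π := (ChainComplex.toSingle₀Equiv K F).symm ⟨ε, hε⟩
  quasiIso := ⟨fun n => by
    cases n with
    | zero =>
      -- In degree $0$ being a quasi-isomorphism amounts to exactness of $K_1\to K_0\to F$ together
      -- with `ε` being epi.
      rw [ChainComplex.quasiIsoAt₀_iff, ShortComplex.quasiIso_iff_of_zeros' _
        (K.shape 0 0 (by simp)) rfl rfl]
      have he : Epi ε := by
        rw [NatTrans.epi_iff_epi_app]
        exact fun j => (AddCommGrpCat.epi_iff_surjective _).2 (hsurj j)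
      refine (ShortComplex.exact_and_epi_g_iff_of_iso
        (S₂ := ShortComplex.mk (K.d 1 0) ε hε) ?_).2 ⟨?_, he⟩
      · exact ShortComplex.isoMk (Iso.refl _) (Iso.refl _) (Iso.refl _)
          ((Category.id_comp (K.d 1 0)).trans (Category.comp_id (K.d 1 0)).symm)
          ((Category.id_comp ε).trans (.trans
            (ChainComplex.toSingle₀Equiv_symm_apply_f_zero ε hε).symm (Category.comp_id _).symm))
      · exact ShortComplex.exact_of_evaluation _ fun j =>
          (ShortComplex.ab_exact_iff_function_exact _).2 (hzero j)
    | succ n =>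
      rw [quasiIsoAt_iff_exactAt' (hL := ChainComplex.exactAt_succ_single_obj ..),
        HomologicalComplex.exactAt_iff' _ (n + 2) (n + 1) n (by simp) (by simp)]
      exact ShortComplex.exact_of_evaluation _ fun j =>
        (ShortComplex.ab_exact_iff_function_exact _).2 (hsucc n j)⟩

/-! ### Exactness of the resolution of $\mathbb Z[x_0]$. -/

namespace DivisorCell

open AbstractSimplicialComplex

variable {E : Type u} {I : E → E → Prop} {X : Type u}
  [MulAction (PartiallyCommMonoid I)ᵐᵒᵖ X] {x₀ pt : X} {n : ℕ}
  {x x' : RightActionCategory (PartiallyCommMonoid I) X}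

local notation "γ" => PresentedMonoid.of (CommutationRel I)

theorem op_smul_eq_of_of_dvd (hpt : ∀ μ : PartiallyCommMonoid I, MulOpposite.op μ • pt = pt)
    (hx₀ : ∀ e : E, MulOpposite.op (γ e) • x₀ = pt) {e : E} {w : PartiallyCommMonoid I}
    (h : γ e ∣ w) : MulOpposite.op w • x₀ = pt := by
  obtain ⟨m, rfl⟩ := h
  rw [MulOpposite.op_mul, mul_smul, hx₀, hpt]

theorem eq_base_of_cell_succ (hpt : ∀ μ : PartiallyCommMonoid I, MulOpposite.op μ • pt = pt)
    (hx₀ : ∀ e : E, MulOpposite.op (γ e) • x₀ = pt) {y : X} (c : DivisorCell I x₀ (n + 1) y) :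
    y = pt := by
  obtain ⟨e, he⟩ := Finset.card_pos.1 (by rw [c.card_eq]; exact Nat.succ_pos n)
  rw [← c.smul_eq, op_smul_eq_of_of_dvd hpt hx₀ (c.dvd e he)]

theorem elt_eq_one (hne : x₀ ≠ pt)
    (hpt : ∀ μ : PartiallyCommMonoid I, MulOpposite.op μ • pt = pt)
    (hx₀ : ∀ e : E, MulOpposite.op (γ e) • x₀ = pt) (c : DivisorCell I x₀ n x₀) : c.elt = 1 := by
  by_contra h
  obtain ⟨e, he⟩ := PartiallyCommMonoid.exists_of_dvd h
  exact hne (c.smul_eq.symm.trans (op_smul_eq_of_of_dvd hpt hx₀ he))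

/-- Supplies the cone points over the base point: $1$ fixes $x_0$, so $w\neq 1$. -/
theorem exists_of_dvd_of_op_smul_eq (hne : x₀ ≠ pt) {w : PartiallyCommMonoid I}
    (h : MulOpposite.op w • x₀ = pt) : ∃ e, γ e ∣ w := by
  refine PartiallyCommMonoid.exists_of_dvd ?_
  rintro rfl
  exact hne (by simpa using h)

theorem pointedCoeff_obj_eq_zero
    (hpt : ∀ μ : PartiallyCommMonoid I, MulOpposite.op μ • pt = pt) (hx : x.back = pt)
    (z : (pointedCoeff (PartiallyCommMonoid I) pt hpt).obj x) : z = 0 :=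
  Subtype.ext (z.2 hx)

open Classical in
/-- The standard generator of the value of `pointedCoeff`. -/
noncomputable def coeffUnit (hpt : ∀ μ : PartiallyCommMonoid I, MulOpposite.op μ • pt = pt)
    (x : RightActionCategory (PartiallyCommMonoid I) X) :
    (pointedCoeff (PartiallyCommMonoid I) pt hpt).obj x :=
  ⟨if x.back = pt then 0 else ⟨1⟩, fun h => if_pos h⟩

open Classical in
theorem pointedCoeff_map_coeffUnit
    (hpt : ∀ μ : PartiallyCommMonoid I, MulOpposite.op μ • pt = pt) (f : x ⟶ x') :
    (pointedCoeff (PartiallyCommMonoid I) pt hpt).map f (coeffUnit hpt x) = coeffUnit hpt x' := by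
  by_cases h' : x'.back = pt
  · exact (pointedCoeff_obj_eq_zero hpt h' _).trans (pointedCoeff_obj_eq_zero hpt h' _).symm
  · have h : x.back ≠ pt := fun h =>
      h' (by rw [← label_smul f, h, ← MulOpposite.op_unop (label f), hpt])
    apply Subtype.ext
    change (if x'.back = pt then 0 else (if x.back = pt then 0 else (⟨1⟩ : ULift ℤ))) =
      if x'.back = pt then 0 else ⟨1⟩
    rw [if_neg h]

open Classical in
theorem down_smul_coeffUnit (hpt : ∀ μ : PartiallyCommMonoid I, MulOpposite.op μ • pt = pt)
    (z : (pointedCoeff (PartiallyCommMonoid I) pt hpt).obj x) :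
    z.1.down • coeffUnit hpt x = z := by
  by_cases h : x.back = pt
  · rw [pointedCoeff_obj_eq_zero hpt h z, pointedCoeff_obj_eq_zero hpt h (_ • _)]
  · apply Subtype.ext
    change z.1.down • (if x.back = pt then 0 else (⟨1⟩ : ULift ℤ)) = z.1
    rw [if_neg h]
    ext
    simp

variable (x₀) in
/-- The augmentation, which sends every cell with no generators to `1`. -/
noncomputable def freeFunctorAugmentation
    (hpt : ∀ μ : PartiallyCommMonoid I, MulOpposite.op μ • pt = pt) :
    freeFunctor I x₀ 0 ⟶ pointedCoeff (PartiallyCommMonoid I) pt hpt where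
  app x := freeFunctorDesc fun _ => coeffUnit hpt x
  naturality x x' f := freeFunctor_obj_hom_ext fun c => by
    rw [ConcreteCategory.comp_apply, ConcreteCategory.comp_apply, freeFunctor_map_basis,
      freeFunctorDesc_basis, freeFunctorDesc_basis, pointedCoeff_map_coeffUnit]

theorem freeFunctorAugmentation_app_basis
    (hpt : ∀ μ : PartiallyCommMonoid I, MulOpposite.op μ • pt = pt)
    (c : DivisorCell I x₀ 0 x.back) :
    (freeFunctorAugmentation x₀ hpt).app x (basis c) = coeffUnit hpt x :=
  freeFunctorDesc_basis _ _

/-- The cell on the unit and no generators. -/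
def unitCell (hx : x.back = x₀) : DivisorCell I x₀ 0 x.back where
  elt := 1
  gens := ∅
  smul_eq := by simp [hx]
  card_eq := rfl
  dvd := by simp

theorem eq_unitCell (hne : x₀ ≠ pt)
    (hpt : ∀ μ : PartiallyCommMonoid I, MulOpposite.op μ • pt = pt)
    (hx₀ : ∀ e : E, MulOpposite.op (γ e) • x₀ = pt) (hx : x.back = x₀)
    (c : DivisorCell I x₀ 0 x.back) : c = unitCell hx := by
  refine DivisorCell.ext ?_ (Finset.card_eq_zero.1 c.card_eq)
  have h (y : X) (hy : y = x₀) (c : DivisorCell I x₀ 0 y) : c.elt = 1 := by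
    subst hy
    exact elt_eq_one hne hpt hx₀ c
  exact h _ hx c

theorem freeFunctorAugmentation_app_surjective (hX : ∀ y : X, y = x₀ ∨ y = pt)
    (hpt : ∀ μ : PartiallyCommMonoid I, MulOpposite.op μ • pt = pt)
    (x : RightActionCategory (PartiallyCommMonoid I) X) :
    Function.Surjective ((freeFunctorAugmentation x₀ hpt).app x) := fun z => by
  rcases hX x.back with hx | hx
  · refine ⟨z.1.down • basis (unitCell hx), ?_⟩
    rw [map_zsmul, freeFunctorAugmentation_app_basis, down_smul_coeffUnit]
  · exact ⟨0, by rw [map_zero, pointedCoeff_obj_eq_zero hpt hx z]⟩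

open Classical in
theorem freeFunctorAugmentation_app_injective (hne : x₀ ≠ pt)
    (hpt : ∀ μ : PartiallyCommMonoid I, MulOpposite.op μ • pt = pt)
    (hx₀ : ∀ e : E, MulOpposite.op (γ e) • x₀ = pt) (hx : x.back = x₀) :
    Function.Injective ((freeFunctorAugmentation x₀ hpt).app x) := by
  let r : (pointedCoeff (PartiallyCommMonoid I) pt hpt).obj x ⟶ (freeFunctor I x₀ 0).obj x :=
    AddCommGrpCat.ofHom
      { toFun := fun z => z.1.down • basis (unitCell hx)
        map_zero' := zero_smul ℤ _
        map_add' := fun a b => add_smul a.1.down b.1.down _ }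
  have h : (freeFunctorAugmentation x₀ hpt).app x ≫ r = 𝟙 _ :=
    freeFunctor_obj_hom_ext fun c => by
      rw [ConcreteCategory.comp_apply, freeFunctorAugmentation_app_basis,
        eq_unitCell hne hpt hx₀ hx c]
      change (if x.back = pt then 0 else (⟨1⟩ : ULift ℤ)).down • basis (unitCell hx) = _
      rw [if_neg (hx ▸ hne)]
      exact one_smul ℤ _
  intro a b hab
  have := congrArg r hab
  simpa only [← ConcreteCategory.comp_apply, h, ConcreteCategory.id_apply] using this

/-- Without generators there is no map `v` into `E` to build the homotopy from, so this case is
settled separately: nothing moves $x_0$ to the base point. -/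
theorem isEmpty_cell_base [IsEmpty E] (hne : x₀ ≠ pt) : IsEmpty (DivisorCell I x₀ n pt) :=
  ⟨fun c => isEmptyElim (exists_of_dvd_of_op_smul_eq hne c.smul_eq).choose⟩

variable [LinearOrder E]

/-- No signs need to cancel: cells with a generator lie only over the base point, where the
coefficient group is zero. -/
theorem freeFunctorD_comp_augmentation
    (hpt : ∀ μ : PartiallyCommMonoid I, MulOpposite.op μ • pt = pt)
    (hx₀ : ∀ e : E, MulOpposite.op (γ e) • x₀ = pt) :
    freeFunctorD I x₀ 0 ≫ freeFunctorAugmentation x₀ hpt = 0 := by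
  ext1; funext x
  exact freeFunctor_obj_hom_ext fun c =>
    (pointedCoeff_obj_eq_zero hpt (eq_base_of_cell_succ hpt hx₀ c) _).trans
      (pointedCoeff_obj_eq_zero hpt (eq_base_of_cell_succ hpt hx₀ c) _).symm

theorem differential_base_surjective (hne : x₀ ≠ pt) :
    Function.Surjective (differential (I := I) x₀ pt 0) := by
  rcases isEmpty_or_nonempty E with _ | _
  · have := isEmpty_cell_base (I := I) (n := 0) hne
    exact fun z => ⟨0, Subsingleton.elim _ _⟩
  · choose! v hv using fun (w : PartiallyCommMonoid I) (h : MulOpposite.op w • x₀ = pt) =>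
      exists_of_dvd_of_op_smul_eq hne h
    exact differential_surjective_of_dvd hv

theorem differential_base_exact (hne : x₀ ≠ pt) :
    Function.Exact (differential (I := I) x₀ pt (n + 1)) (differential x₀ pt n) := by
  rcases isEmpty_or_nonempty E with _ | _
  · have := isEmpty_cell_base (I := I) (n := n) hne
    have := isEmpty_cell_base (I := I) (n := n + 1) hne
    exact fun z => ⟨fun _ => ⟨0, Subsingleton.elim _ _⟩, fun _ => Subsingleton.elim _ _⟩
  · choose! v hv using fun (w : PartiallyCommMonoid I) (h : MulOpposite.op w • x₀ = pt) =>
      exists_of_dvd_of_op_smul_eq hne h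
    exact differential_exact_of_dvd hv

theorem freeFunctorD_app_exact (hne : x₀ ≠ pt)
    (hpt : ∀ μ : PartiallyCommMonoid I, MulOpposite.op μ • pt = pt)
    (hx₀ : ∀ e : E, MulOpposite.op (γ e) • x₀ = pt)
    (x : RightActionCategory (PartiallyCommMonoid I) X) :
    Function.Exact ((freeFunctorD I x₀ (n + 1)).app x) ((freeFunctorD I x₀ n).app x) := by
  have h (y : X) : Function.Exact (differential (I := I) x₀ y (n + 1)) (differential x₀ y n) := by
    rcases eq_or_ne y pt with rfl | hy
    · exact differential_base_exact hne
    · have : IsEmpty (DivisorCell I x₀ (n + 1) y) :=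
        ⟨fun c => hy (eq_base_of_cell_succ hpt hx₀ c)⟩
      exact fun z => ⟨fun _ => ⟨0, Subsingleton.elim _ _⟩, fun _ => by
        rw [Subsingleton.elim z 0, map_zero]⟩
  exact h x.back

theorem freeFunctorAugmentation_app_exact (hne : x₀ ≠ pt) (hX : ∀ y : X, y = x₀ ∨ y = pt)
    (hpt : ∀ μ : PartiallyCommMonoid I, MulOpposite.op μ • pt = pt)
    (hx₀ : ∀ e : E, MulOpposite.op (γ e) • x₀ = pt)
    (x : RightActionCategory (PartiallyCommMonoid I) X) :
    Function.Exact ((freeFunctorD I x₀ 0).app x) ((freeFunctorAugmentation x₀ hpt).app x) := by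
  intro z
  constructor
  -- Over $x_0$ the augmentation is injective, since `unitCell` is the only cell; over the base
  -- point the differential is already surjective.
  · intro hz
    rcases hX x.back with hx | hx
    · refine ⟨0, ?_⟩
      rw [map_zero]
      exact (freeFunctorAugmentation_app_injective hne hpt hx₀ hx
        (hz.trans (map_zero _).symm)).symm
    · have h (y : X) (hy : y = pt) : Function.Surjective (differential (I := I) x₀ y 0) := by
        subst hy
        exact differential_base_surjective hne
      exact h _ hx z
  · rintro ⟨z, rfl⟩
    have := NatTrans.congr_app (freeFunctorD_comp_augmentation hpt hx₀) x
    exact ConcreteCategory.congr_hom this z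

/-- The projective resolution of `pointedCoeff` by the functors `freeFunctor`. -/
noncomputable def projectiveResolution (hsymm : ∀ a b, I a b → I b a) (hne : x₀ ≠ pt)
    (hX : ∀ y : X, y = x₀ ∨ y = pt)
    (hpt : ∀ μ : PartiallyCommMonoid I, MulOpposite.op μ • pt = pt)
    (hx₀ : ∀ e : E, MulOpposite.op (γ e) • x₀ = pt) :
    ProjectiveResolution (pointedCoeff (PartiallyCommMonoid I) pt hpt) :=
  ProjectiveResolution.ofPointwiseExact (freeComplex I x₀) (freeFunctorAugmentation x₀ hpt)
    (by rw [freeComplex_d]; exact freeFunctorD_comp_augmentation hpt hx₀)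
    (fun _ => projective_freeFunctor hsymm)
    (freeFunctorAugmentation_app_surjective hX hpt)
    (fun x => by
      rw [freeComplex_d]
      exact freeFunctorAugmentation_app_exact hne hX hpt hx₀ x)
    (fun n x => by
      rw [freeComplex_d, freeComplex_d]
      exact freeFunctorD_app_exact hne hpt hx₀ x)

end DivisorCell

/-! ### Identification of the colimit with the augmented simplicial chains. -/

namespace DivisorCell

open AbstractSimplicialComplex

variable {E : Type u} [LinearOrder E] {I : E → E → Prop} {X : Type u}
  [MulAction (PartiallyCommMonoid I)ᵐᵒᵖ X] {x₀ pt : X} {n : ℕ}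
  {x x' : RightActionCategory (PartiallyCommMonoid I) X}

/-- A nonempty commuting set as a simplex. -/
def _root_.CommutingSet.toSimplex (t : CommutingSet I (n + 1)) : (commutingComplex I).Simplex n :=
  ⟨t.1, ⟨Finset.card_pos.1 (by omega), t.2.2⟩, t.2.1⟩

/-- The basis of the augmented simplicial chain complex. -/
noncomputable def chainBasis :
    ∀ n, CommutingSet I n → (commutingComplex I).augmentedChainComplex.X n
  | 0 => fun _ => ULift.up (1 : ℤ)
  | _ + 1 => fun t => Finsupp.single t.toSimplex (1 : ℤ)

/-- The chain groups are free on commuting sets. In degree $0$ the group $\mathbb Z$ is free on the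
empty set; in degree $n+1$ the basis is the $n$-simplices. -/
theorem existsUnique_hom_chainBasis (n : ℕ) (B : AddCommGrpCat.{u}) (φ : CommutingSet I n → B) :
    ∃! ψ : (commutingComplex I).augmentedChainComplex.X n ⟶ B, ∀ t, ψ (chainBasis n t) = φ t := by
  cases n with
  | zero =>
    let t₀ : CommutingSet I 0 := ⟨∅, rfl, by simp⟩
    refine ⟨AddCommGrpCat.ofHom
      ((zmultiplesHom B (φ t₀)).comp AddEquiv.ulift.toAddMonoidHom), fun t => ?_, fun ψ hψ => ?_⟩
    · rw [show t = t₀ from Subtype.ext (Finset.card_eq_zero.1 t.2.1)]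
      exact one_smul ℤ (φ t₀)
    · ext1
      refine AddMonoidHom.ext fun (z : ULift ℤ) => ?_
      have hz : z = z.down • (ULift.up 1 : ULift ℤ) := by ext; simp
      refine .trans ?_ (congrArg (z.down • ·) (hψ t₀))
      exact (congrArg ψ.hom hz).trans (map_zsmul ψ.hom _ _)
  | succ n =>
    refine ⟨AddCommGrpCat.ofHom (Finsupp.liftAddHom fun s : (commutingComplex I).Simplex n =>
      zmultiplesHom B (φ ⟨s.1, s.2.2, s.2.1.2⟩)), fun t => ?_, fun ψ hψ => ?_⟩
    · refine (Finsupp.liftAddHom_apply_single _ _ _).trans ?_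
      exact one_smul ℤ (φ t)
    · ext1
      refine Finsupp.addHom_ext' fun s => AddMonoidHom.ext_int ?_
      refine (hψ ⟨s.1, s.2.2, s.2.1.2⟩).trans ?_
      refine .trans ?_ (Finsupp.liftAddHom_apply_single _ _ _).symm
      exact (one_smul ℤ _).symm

variable (x₀ n x) in
/-- The map to the group of chains which sends a cell to its set of generators. -/
noncomputable def toChains (hsymm : ∀ a b, I a b → I b a) :
    (freeFunctor I x₀ n).obj x ⟶ (commutingComplex I).augmentedChainComplex.X n :=
  (commutingSetCocone hsymm (chainBasis n)).ι.app x

theorem toChains_basis (hsymm : ∀ a b, I a b → I b a) (c : DivisorCell I x₀ n x.back) :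
    toChains x₀ n x hsymm (basis c) = chainBasis n (c.commutingSet hsymm) :=
  commutingSetCocone_app_basis hsymm _ c

variable (x₀ n) in
/-- The colimit of `freeFunctor` is the group of chains. -/
noncomputable def colimitIsoChains (hsymm : ∀ a b, I a b → I b a) :
    colimit (freeFunctor I x₀ n) ≅ (commutingComplex I).augmentedChainComplex.X n :=
  (colimit.isColimit (freeFunctor I x₀ n)).coconePointUniqueUpToIso
    (isColimitCommutingSetCocone hsymm _ (existsUnique_hom_chainBasis n))

theorem ι_colimitIsoChains_hom (hsymm : ∀ a b, I a b → I b a) :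
    colimit.ι (freeFunctor I x₀ n) x ≫ (colimitIsoChains x₀ n hsymm).hom =
      toChains x₀ n x hsymm :=
  (colimit.isColimit (freeFunctor I x₀ n)).comp_coconePointUniqueUpToIso_hom
    (isColimitCommutingSetCocone hsymm _ (existsUnique_hom_chainBasis n)) x

theorem augmentedChainComplex_d_chainBasis_one (t : CommutingSet I 1) (t₀ : CommutingSet I 0) :
    (commutingComplex I).augmentedChainComplex.d 1 0 (chainBasis 1 t) = chainBasis 0 t₀ := by
  refine (Finsupp.linearCombination_single ℤ (1 : ℤ) t.toSimplex).trans ?_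
  exact one_smul ℤ (ULift.up (1 : ℤ))

theorem augmentedChainComplex_d_chainBasis_succ (t : CommutingSet I (n + 2)) :
    (commutingComplex I).augmentedChainComplex.d (n + 2) (n + 1) (chainBasis (n + 2) t) =
      ∑ v : {v : E // v ∈ t.1}, (-1 : ℤ) ^ vertexIndex t.1 v.1 •
        chainBasis (I := I) (n + 1) ⟨t.1.erase v.1, by
          rw [Finset.card_erase_of_mem v.2, t.2.1]; rfl,
          t.2.2.mono (by simp)⟩ := by
  have h : (commutingComplex I).augmentedChainComplex.d (n + 2) (n + 1) =
      AddCommGrpCat.ofHom ((commutingComplex I).boundary n).toAddMonoidHom :=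
    ChainComplex.of_d (fun n => AddCommGrpCat.of ((commutingComplex I).Simplex n →₀ ℤ))
      (fun n => AddCommGrpCat.ofHom ((commutingComplex I).boundary n).toAddMonoidHom) n
  rw [h]
  exact (commutingComplex I).boundary_single t.toSimplex

theorem toChains_comp_d (hsymm : ∀ a b, I a b → I b a) :
    toChains x₀ (n + 1) x hsymm ≫ (commutingComplex I).augmentedChainComplex.d (n + 1) n =
      (freeFunctorD I x₀ n).app x ≫ toChains x₀ n x hsymm := by
  refine freeFunctor_obj_hom_ext fun c => ?_
  rw [ConcreteCategory.comp_apply, ConcreteCategory.comp_apply, freeFunctorD_app_basis,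
    toChains_basis, map_sum]
  simp only [map_zsmul, toChains_basis]
  -- The lowest differential is the augmentation: a one-element set has a single face, the empty
  -- set, with sign $(-1)^0$. Above it both differentials are the same alternating sum.
  cases n with
  | zero =>
    obtain ⟨e, he⟩ := Finset.card_eq_one.1 c.card_eq
    let t₀ : CommutingSet I 0 := ⟨∅, rfl, by simp⟩
    rw [augmentedChainComplex_d_chainBasis_one _ t₀]
    have h (v : {v : E // v ∈ c.gens}) : vertexIndex c.gens v.1 = 0 := by
      have : v.1 = e := by simpa [he] using v.2
      simp [vertexIndex, he, this, Finset.filter_singleton]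
    have hu (t : CommutingSet I 0) : chainBasis 0 t = chainBasis 0 t₀ := rfl
    simp only [h, hu, pow_zero, Finset.sum_const, Finset.card_univ, Fintype.card_coe,
      c.card_eq]
    rw [one_smul, zero_add, one_smul]
  | succ n => exact augmentedChainComplex_d_chainBasis_succ _

theorem colimitIsoChains_hom_comp_d (hsymm : ∀ a b, I a b → I b a) :
    (colimitIsoChains x₀ (n + 1) hsymm).hom ≫
        (commutingComplex I).augmentedChainComplex.d (n + 1) n =
      colim.map (freeFunctorD I x₀ n) ≫ (colimitIsoChains x₀ n hsymm).hom := by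
  refine colimit.hom_ext fun x => ?_
  rw [← Category.assoc, ι_colimitIsoChains_hom, toChains_comp_d, ← Category.assoc,
    colimit.ι_map, Category.assoc, ι_colimitIsoChains_hom]

/-- The colimit of the complex of the functors `freeFunctor` is the augmented simplicial chain
complex. -/
noncomputable def colimFreeComplexIso (hsymm : ∀ a b, I a b → I b a) :
    ((colim (J := RightActionCategory (PartiallyCommMonoid I) X)
      (C := AddCommGrpCat.{u})).mapHomologicalComplex _).obj (freeComplex I x₀) ≅
        (commutingComplex I).augmentedChainComplex :=
  HomologicalComplex.Hom.isoOfComponents (fun n => colimitIsoChains x₀ n hsymm) (by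
    rintro _ n rfl
    refine (colimitIsoChains_hom_comp_d hsymm).trans ?_
    rw [← freeComplex_d]
    rfl)

end DivisorCell

theorem mainTheorem2 {E : Type u} [Finite E] [LinearOrder E]
    (I : E → E → Prop) (hirr : ∀ a, ¬ I a a) (hsymm : ∀ a b, I a b → I b a)
    {X : Type u} [MulAction (PartiallyCommMonoid I)ᵐᵒᵖ X]
    (x₀ pt : X) (hne : x₀ ≠ pt) (hX : ∀ x : X, x = x₀ ∨ x = pt)
    (hpt : ∀ μ : PartiallyCommMonoid I, MulOpposite.op μ • pt = pt)
    (hx₀ : ∀ e : E, MulOpposite.op (PresentedMonoid.of (CommutationRel I) e) • x₀ = pt)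
    (n : ℕ) (hn : 1 ≤ n) :
    Nonempty (derivedColim n (pointedCoeff (PartiallyCommMonoid I) pt hpt) ≅
      (commutingComplex I).reducedHomology (n - 1)) := by
  obtain ⟨m, rfl⟩ := Nat.exists_eq_add_of_le' hn
  -- With $n=m+1$, reduced homology in degree $m$ is by definition the homology of the augmented
  -- complex in degree $m+1$, so no further reindexing is needed.
  exact ⟨(DivisorCell.projectiveResolution hsymm hne hX hpt hx₀).isoLeftDerivedObj colim (m + 1) ≪≫
    (HomologicalComplex.homologyFunctor _ _ (m + 1)).mapIso
      (DivisorCell.colimFreeComplexIso hsymm)⟩
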